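/- Let $(\mathcal{A},\mathbb{E},\mathfrak{s})$ be an extriangulated category in the sense of Nakaoka–Palu: $\mathcal A$ is an additive category, $\mathbb{E}\colon\mathcal{A}^{\mathrm{op}}\times\mathcal{A}\to\mathrm{Ab}$ is an additive bifunctor, and $\mathfrak{s}$ is an additive realization of $\mathbb{E}$ such that axioms (ET3), (ET3)$^{\mathrm{op}}$, (ET4) and (ET4)$^{\mathrm{op}}$ hold. An $\mathbb{E}$-triangle $X\xrightarrow{x}L\xrightarrow{y}M\overset{\delta}{\dashrightarrow}$ consists of $\delta\in\mathbb{E}(M,X)$ and a sequence with $\mathfrak{s}(\delta)=[X\xrightarrow{x}L\xrightarrow{y}M]$; then $x$ is called an inflation with cone $M$. Let $\mathcal{X}$ be a simple-minded system in $\mathcal{A}$, that is, a collection of objects closed under isomorphism such that (a) the endomorphism ring of every $X\in\mathcal{X}$ is a division ring, and $\mathrm{Hom}(X_1,X_2)=0$ for any two non-isomorphic $X_1,X_2\in\mathcal{X}$; (b) every object $M$ of $\mathcal{A}$ admits an $\mathcal{X}$-filtration, i.e. a finite chain of inflations $0=M_0\to M_1\to\cdots\to M_n=M$ (of length $n\ge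 0$) whose cones all lie in $\mathcal{X}$. For an object $M$ let $l_{\mathcal{X}}(M)\in\mathbb{N}$ be the minimal length of an $\mathcal{X}$-filtration of $M$. Then $(\mathcal{A},l_{\mathcal{X}})$ is an extriangulated length category, which means the following. (1) $l_{\mathcal{X}}$ is a length function: it is constant on isomorphism classes; $l_{\mathcal{X}}(M)=0$ if and only if $M\cong 0$; and for every $\mathbb{E}$-triangle $X\to L\to M\overset{\delta}{\dashrightarrow}$ one has $l_{\mathcal{X}}(L)\le l_{\mathcal{X}}(X)+l_{\mathcal{X}}(M)$, with equality if $\delta=0$. (2) Every morphism $f\colon M\to N$ in $\mathcal{A}$ is $l_{\mathcal{X}}$-admissible: there are an object $X_f$, an $l_{\mathcal{X}}$-deflation $i_f\colon M\to X_f$ and an $l_{\mathcal{X}}$-inflation $j_f\colon X_f\to N$ with $f=j_f i_f$. Here an $l_{\mathcal{X}}$-inflation (resp. $l_{\mathcal{X}}$-deflation) is the map $x$ (resp. $y$) in some $\mathbb{E}$-triangle $X\xrightarrow{x}L\xrightarrow{y}M\dashrightarrow$ with $l_{\mathcal{X}}(L)=l_{\mathcal{X}}(X)+l_{\mathcal{X}}(M)$.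 -/

import Mathlib

open CategoryTheory CategoryTheory.Limits Opposite

universe w v u

namespace Extri

section Bifunctor

variable {C : Type u} [Category.{v} C] (E : Cᵒᵖ ⥤ C ⥤ AddCommGrpCat.{w})

/-- The abelian group `𝔼(Z, X)` of extensions. -/
abbrev Extn (Z X : C) : Type w := (E.obj (op Z)).obj X

/-- `a_* δ = 𝔼(Z, a)(δ)`. -/
def push {Z X X' : C} (a : X ⟶ X') (δ : Extn E Z X) : Extn E Z X' :=
  ((E.obj (op Z)).map a).hom δ

/-- `c^* δ = 𝔼(c, X)(δ)`. -/
def pull {Z Z' X : C} (c : Z' ⟶ Z) (δ : Extn E Z X) : Extn E Z' X :=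
  ((E.map c.op).app X).hom δ

/-- The direct sum `δ ⊕ δ'` of two extensions: the element of `𝔼(Z ⊞ Z', X ⊞ X')` that corresponds
to `(δ, 0, 0, δ')` under the decomposition given by the additivity of `𝔼`. -/
noncomputable def directSum [Preadditive C] [HasBinaryBiproducts C] {Z X Z' X' : C}
    (δ : Extn E Z X) (δ' : Extn E Z' X') : Extn E (Z ⊞ Z') (X ⊞ X') :=
  push E biprod.inl (pull E biprod.fst δ) + push E biprod.inr (pull E biprod.snd δ')

end Bifunctor

/-- An extriangulated structure (Nakaoka–Palu) on an additive category `C`.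

The realization `𝔰`, which assigns to each `δ ∈ 𝔼(Z, X)` an equivalence class of sequences
`X ⟶ Y ⟶ Z`, is given by the relation `Tri x y δ`, meaning `𝔰(δ) = [X --x--> Y --y--> Z]`, i.e.
`X --x--> Y --y--> Z --δ-->` is an `𝔼`-triangle. -/
structure ExtriStructure (C : Type u) [Category.{v} C] [Preadditive C] [HasZeroObject C]
    [HasBinaryBiproducts C] where
  /-- the bifunctor `𝔼 : Cᵒᵖ × C ⥤ Ab` -/
  E : Cᵒᵖ ⥤ C ⥤ AddCommGrpCat.{w}
  -- (ET1) `𝔼` is additive in each variable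
  additive_right : ∀ Z : C, (E.obj (op Z)).Additive
  additive_left : ∀ X : C, (E.flip.obj X).Additive
  /-- the relation `𝔰(δ) = [x, y]` -/
  Tri : ∀ {X Y Z : C}, (X ⟶ Y) → (Y ⟶ Z) → Extn E Z X → Prop
  -- the sequences realizing a given `δ` form exactly one equivalence class
  exists_tri : ∀ {X Z : C} (δ : Extn E Z X), ∃ (Y : C) (x : X ⟶ Y) (y : Y ⟶ Z), Tri x y δ
  tri_unique : ∀ {X Y Y' Z : C} {δ : Extn E Z X} {x : X ⟶ Y} {y : Y ⟶ Z}
    {x' : X ⟶ Y'} {y' : Y' ⟶ Z}, Tri x y δ → Tri x' y' δ →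
    ∃ e : Y ≅ Y', x ≫ e.hom = x' ∧ e.hom ≫ y' = y
  tri_of_iso : ∀ {X Y Y' Z : C} {δ : Extn E Z X} {x : X ⟶ Y} {y : Y ⟶ Z}
    {x' : X ⟶ Y'} {y' : Y' ⟶ Z} (e : Y ≅ Y'), x ≫ e.hom = x' → e.hom ≫ y' = y →
    Tri x y δ → Tri x' y' δ
  -- (ET2) `𝔰` is a realization ...
  realize_hom : ∀ {X Y Z X' Y' Z' : C} {x : X ⟶ Y} {y : Y ⟶ Z} {δ : Extn E Z X}
    {x' : X' ⟶ Y'} {y' : Y' ⟶ Z'} {δ' : Extn E Z' X'}, Tri x y δ → Tri x' y' δ' →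
    ∀ (a : X ⟶ X') (c : Z ⟶ Z'), push E a δ = pull E c δ' →
    ∃ b : Y ⟶ Y', x ≫ b = a ≫ x' ∧ y ≫ c = b ≫ y'
  -- ... which is additive
  tri_zero : ∀ X Z : C, Tri (biprod.inl : X ⟶ X ⊞ Z) (biprod.snd : X ⊞ Z ⟶ Z) (0 : Extn E Z X)
  tri_directSum : ∀ {X Y Z X' Y' Z' : C} {x : X ⟶ Y} {y : Y ⟶ Z} {δ : Extn E Z X}
    {x' : X' ⟶ Y'} {y' : Y' ⟶ Z'} {δ' : Extn E Z' X'}, Tri x y δ → Tri x' y' δ' →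
    Tri (biprod.map x x') (biprod.map y y') (directSum E δ δ')
  -- (ET3)
  et3 : ∀ {X Y Z X' Y' Z' : C} {x : X ⟶ Y} {y : Y ⟶ Z} {δ : Extn E Z X}
    {x' : X' ⟶ Y'} {y' : Y' ⟶ Z'} {δ' : Extn E Z' X'}, Tri x y δ → Tri x' y' δ' →
    ∀ (a : X ⟶ X') (b : Y ⟶ Y'), x ≫ b = a ≫ x' →
    ∃ c : Z ⟶ Z', y ≫ c = b ≫ y' ∧ push E a δ = pull E c δ'
  -- (ET3)ᵒᵖ
  et3_op : ∀ {X Y Z X' Y' Z' : C} {x : X ⟶ Y} {y : Y ⟶ Z} {δ : Extn E Z X}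
    {x' : X' ⟶ Y'} {y' : Y' ⟶ Z'} {δ' : Extn E Z' X'}, Tri x y δ → Tri x' y' δ' →
    ∀ (b : Y ⟶ Y') (c : Z ⟶ Z'), y ≫ c = b ≫ y' →
    ∃ a : X ⟶ X', x ≫ b = a ≫ x' ∧ push E a δ = pull E c δ'
  -- (ET4)
  et4 : ∀ {A B D K F : C} {f : A ⟶ B} {f' : B ⟶ D} {δ : Extn E D A}
    {g : B ⟶ K} {g' : K ⟶ F} {δ' : Extn E F B}, Tri f f' δ → Tri g g' δ' →
    ∃ (L : C) (h' : K ⟶ L) (d : D ⟶ L) (e : L ⟶ F) (δ'' : Extn E L A),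
      Tri (f ≫ g) h' δ'' ∧ f' ≫ d = g ≫ h' ∧ h' ≫ e = g' ∧
      Tri d e (push E f' δ') ∧ pull E d δ'' = δ ∧ push E f δ'' = pull E e δ'
  -- (ET4)ᵒᵖ
  et4_op : ∀ {A B D K F : C} {f' : D ⟶ A} {f : A ⟶ B} {δ : Extn E B D}
    {g' : F ⟶ B} {g : B ⟶ K} {δ' : Extn E K F}, Tri f' f δ → Tri g' g δ' →
    ∃ (L : C) (d : D ⟶ L) (e : L ⟶ F) (h' : L ⟶ A) (δ'' : Extn E K L),
      Tri h' (f ≫ g) δ'' ∧ d ≫ h' = f' ∧ h' ≫ f = e ≫ g' ∧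
      Tri d e (pull E g' δ) ∧ push E e δ'' = δ' ∧ push E d δ = pull E g δ''

section Semibrick

variable {C : Type u} [Category.{v} C] [Preadditive C]

/-- A brick: an object whose endomorphism ring is a division ring. -/
def IsBrick (X : C) : Prop :=
  Nontrivial (End X) ∧ ∀ f : End X, f ≠ 0 → IsUnit f

/-- A semibrick: a collection of isomorphism classes of bricks with no nonzero morphisms between
non-isomorphic members. -/
structure IsSemibrick (𝒳 : ObjectProperty C) : Prop where
  closed : 𝒳.IsClosedUnderIsomorphisms
  brick : ∀ X : C, 𝒳 X → IsBrick X
  hom_zero : ∀ X Y : C, 𝒳 X → 𝒳 Y → ¬ Nonempty (X ≅ Y) → ∀ f : X ⟶ Y, f = 0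

end Semibrick

namespace ExtriStructure

variable {C : Type u} [Category.{v} C] [Preadditive C] [HasZeroObject C] [HasBinaryBiproducts C]
  (S : ExtriStructure.{w} C)

/-- `S.HasFiltration 𝒳 n M`: there is a filtration `0 = M₀ ⟶ M₁ ⟶ ⋯ ⟶ Mₙ = M` of length `n` whose
maps are inflations with cones in `𝒳`. -/
inductive HasFiltration (𝒳 : ObjectProperty C) : ℕ → C → Prop
  | zero {M : C} (hM : IsZero M) : HasFiltration 𝒳 0 M
  | succ {n : ℕ} {M N X : C} (hM : HasFiltration 𝒳 n M) (f : M ⟶ N) (g : N ⟶ X)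
      (δ : Extn S.E X M) (h : S.Tri f g δ) (hX : 𝒳 X) : HasFiltration 𝒳 (n + 1) N

/-- The filtration subcategory `Filt(𝒳)`. -/
def Filt (𝒳 : ObjectProperty C) : ObjectProperty C :=
  fun M => ∃ n, S.HasFiltration 𝒳 n M

/-- The `𝒳`-length of `M`: the minimal length of an `𝒳`-filtration of `M`
(meaningful for `M` in `Filt(𝒳)`). -/
noncomputable def filtLength (𝒳 : ObjectProperty C) (M : C) : ℕ :=
  sInf {n | S.HasFiltration 𝒳 n M}

/-- A simple-minded system: a semibrick `𝒳` such that every object lies in `Filt(𝒳)`. -/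
structure IsSimpleMindedSystem (𝒳 : ObjectProperty C) : Prop where
  semibrick : IsSemibrick 𝒳
  filt_eq_top : ∀ M : C, S.Filt 𝒳 M

/-- A length function, i.e. a suitable map from isomorphism classes of objects to `ℕ`. -/
structure IsLengthFunction (Θ : C → ℕ) : Prop where
  iso_invariant : ∀ X Y : C, Nonempty (X ≅ Y) → Θ X = Θ Y
  eq_zero_iff : ∀ X : C, Θ X = 0 ↔ IsZero X
  subadditive : ∀ {X L M : C} (x : X ⟶ L) (y : L ⟶ M) (δ : Extn S.E M X),
    S.Tri x y δ → Θ L ≤ Θ X + Θ M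
  additive_of_split : ∀ {X L M : C} (x : X ⟶ L) (y : L ⟶ M),
    S.Tri x y (0 : Extn S.E M X) → Θ L = Θ X + Θ M

/-- A `Θ`-stable `𝔼`-triangle. -/
def IsStable (Θ : C → ℕ) {X L M : C} (x : X ⟶ L) (y : L ⟶ M) (δ : Extn S.E M X) : Prop :=
  S.Tri x y δ ∧ Θ L = Θ X + Θ M

/-- A `Θ`-inflation: the first map of a `Θ`-stable `𝔼`-triangle. -/
def IsInflation (Θ : C → ℕ) {X L : C} (x : X ⟶ L) : Prop :=
  ∃ (M : C) (y : L ⟶ M) (δ : Extn S.E M X), S.IsStable Θ x y δ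

/-- A `Θ`-deflation: the second map of a `Θ`-stable `𝔼`-triangle. -/
def IsDeflation (Θ : C → ℕ) {L M : C} (y : L ⟶ M) : Prop :=
  ∃ (X : C) (x : X ⟶ L) (δ : Extn S.E M X), S.IsStable Θ x y δ

/-- `f` is `Θ`-admissible: it is a `Θ`-deflation followed by a `Θ`-inflation. -/
def IsAdmissible (Θ : C → ℕ) {M N : C} (f : M ⟶ N) : Prop :=
  ∃ (X : C) (i : M ⟶ X) (j : X ⟶ N), S.IsDeflation Θ i ∧ S.IsInflation Θ j ∧ i ≫ j = f

/-- `(C, Θ)` is an extriangulated length category. -/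
structure IsLengthCategory (Θ : C → ℕ) : Prop where
  lengthFunction : S.IsLengthFunction Θ
  admissible : ∀ {M N : C} (f : M ⟶ N), S.IsAdmissible Θ f

end ExtriStructure

end Extri

/-!
The engine is that every nonzero morphism `f : M ⟶ T` to a member of `𝒳` is a deflation: if
`T' ⟶ M ⟶ M'` is the first step of a filtration of `M`, then either `f` restricts to an
isomorphism `T' ⟶ T`, and the triangle splits, or `f` factors through the shorter `M'`. The fibre
has a filtration with one factor less, so `f` is even an `l_𝒳`-deflation. Dually, every nonzero
morphism from a member of `𝒳` is an `l_𝒳`-inflation. This is where the minimality of `l_𝒳` matters,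
since the lengths of the filtrations of an object vary: in a triangulated category `0` is an
extension of `T` by `T[-1]`.

For admissibility, induct on `l_𝒳(M) + l_𝒳(N)`. If `f : M ⟶ N` kills a nonzero morphism `T ⟶ M`
with `T` in `𝒳`, then it factors through the cone of that morphism; if it is killed by a nonzero
morphism `N ⟶ T`, then it factors through its fibre. If neither happens, then `f` is an isomorphism:
choose a nonzero `T ⟶ M`, apply induction to the map between the cones of `T ⟶ M` and `T ⟶ N`, and
conclude by the five lemma. That the map between the cones is again killed by no nonzero morphism to
`T` rests on the same property of `l_𝒳`-deflations: if `L ⟶ M` is an `l_𝒳`-deflation killed by a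
nonzero `M ⟶ T`, then `L` is a retract of the fibre of the composite `0 : L ⟶ T`, whose length is at
most `l_𝒳(L) - 1`, whereas retracts are never longer.
-/

namespace Extri

section Preadditive

variable {C : Type u} [Category.{v} C]

theorem isIso_of_isIso_comp_comp {A B : C} (f : A ⟶ B) (g : B ⟶ A) [IsIso (f ≫ g)]
    [IsIso (g ≫ f)] : IsIso f := by
  have : IsSplitMono f := ⟨⟨⟨g ≫ inv (f ≫ g), by rw [← Category.assoc, IsIso.hom_inv_id]⟩⟩⟩
  have : Epi f := epi_of_epi g f
  exact isIso_of_epi_of_isSplitMono f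

variable [Preadditive C] {𝒳 : ObjectProperty C}

theorem isIso_of_sub_comp_sub_eq_zero {X : C} {f : X ⟶ X} (h : (𝟙 X - f) ≫ (𝟙 X - f) = 0) :
    IsIso f := by
  have hnil : IsNilpotent (1 - (show End X from f)) := ⟨2, by rw [sq]; exact h⟩
  rw [← isUnit_iff_isIso]
  simpa only [sub_sub_cancel] using hnil.isUnit_one_sub

theorem IsBrick.id_ne_zero {X : C} (hX : IsBrick X) : 𝟙 X ≠ 0 :=
  have := hX.1
  one_ne_zero (α := End X)

theorem IsSemibrick.isIso_of_ne_zero (h𝒳 : IsSemibrick 𝒳) {X Y : C} (hX : 𝒳 X) (hY : 𝒳 Y)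
    {f : X ⟶ Y} (hf : f ≠ 0) : IsIso f := by
  obtain ⟨e⟩ : Nonempty (X ≅ Y) := by
    by_contra h
    exact hf (h𝒳.hom_zero X Y hX hY h f)
  have hfe : f ≫ e.inv ≠ 0 := fun h0 => hf ((cancel_mono e.inv).1 (by rw [h0, zero_comp]))
  have : IsIso (f ≫ e.inv) := (isUnit_iff_isIso _).1 ((h𝒳.brick X hX).2 _ hfe)
  exact IsIso.of_isIso_comp_right f e.inv

/-- A morphism is monic on `𝒳` if it kills no nonzero morphism whose source is in `𝒳`. Otherwise
it factors through the cone of such a morphism. -/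
def IsMonoOn (𝒳 : ObjectProperty C) {M N : C} (f : M ⟶ N) : Prop :=
  ∀ ⦃T : C⦄, 𝒳 T → ∀ g : T ⟶ M, g ≫ f = 0 → g = 0

/-- A morphism is epic on `𝒳` if it is killed by no nonzero morphism whose target is in `𝒳`.
Otherwise it factors through the fibre of such a morphism. -/
def IsEpiOn (𝒳 : ObjectProperty C) {M N : C} (f : M ⟶ N) : Prop :=
  ∀ ⦃T : C⦄, 𝒳 T → ∀ g : N ⟶ T, f ≫ g = 0 → g = 0

theorem IsEpiOn.comp {L M N : C} {f : L ⟶ M} {g : M ⟶ N} (hf : IsEpiOn 𝒳 f)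
    (hg : IsEpiOn 𝒳 g) : IsEpiOn 𝒳 (f ≫ g) := fun _ hT h hfgh =>
  hg hT h (hf hT (g ≫ h) (by rw [← Category.assoc, hfgh]))

theorem IsEpiOn.of_comp {L M N : C} {f : L ⟶ M} {g : M ⟶ N} (hfg : IsEpiOn 𝒳 (f ≫ g)) :
    IsEpiOn 𝒳 g := fun _ hT h hgh =>
  hfg hT h (by rw [Category.assoc, hgh, comp_zero])

end Preadditive

section Bifunctor

variable {C : Type u} [Category.{v} C] (E : Cᵒᵖ ⥤ C ⥤ AddCommGrpCat.{w})

@[simp]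
theorem push_id {Z X : C} (δ : Extn E Z X) : push E (𝟙 X) δ = δ := by
  simp [push]

theorem push_comp {Z X X' X'' : C} (a : X ⟶ X') (b : X' ⟶ X'') (δ : Extn E Z X) :
    push E (a ≫ b) δ = push E b (push E a δ) := by
  simp [push]

@[simp]
theorem push_zero {Z X X' : C} (a : X ⟶ X') : push E a (0 : Extn E Z X) = 0 := by
  simp [push]

@[simp]
theorem pull_id {Z X : C} (δ : Extn E Z X) : pull E (𝟙 Z) δ = δ := by
  simp [pull]

theorem pull_comp {Z Z' Z'' X : C} (a : Z'' ⟶ Z') (b : Z' ⟶ Z) (δ : Extn E Z X) :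
    pull E (a ≫ b) δ = pull E a (pull E b δ) := by
  simp [pull]

@[simp]
theorem pull_zero {Z Z' X : C} (c : Z' ⟶ Z) : pull E c (0 : Extn E Z X) = 0 := by
  simp [pull]

theorem push_pull {Z Z' X X' : C} (a : X ⟶ X') (c : Z' ⟶ Z) (δ : Extn E Z X) :
    push E a (pull E c δ) = pull E c (push E a δ) :=
  (ConcreteCategory.congr_hom ((E.map c.op).naturality a) δ).symm

theorem push_inv_eq_pull_inv {Z Z' X X' : C} {a : X ⟶ X'} {c : Z ⟶ Z'} [IsIso a] [IsIso c]
    {δ : Extn E Z X} {δ' : Extn E Z' X'} (h : push E a δ = pull E c δ') :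
    push E (inv a) δ' = pull E (inv c) δ := by
  calc push E (inv a) δ'
      = push E (inv a) (pull E (inv c) (pull E c δ')) := by
        rw [← pull_comp, IsIso.inv_hom_id, pull_id]
    _ = pull E (inv c) (push E (inv a) (push E a δ)) := by rw [← h, push_pull]
    _ = pull E (inv c) δ := by rw [← push_comp, IsIso.hom_inv_id, push_id]

end Bifunctor

namespace ExtriStructure

variable {C : Type u} [Category.{v} C] [Preadditive C] [HasZeroObject C] [HasBinaryBiproducts C]

section Triangles

variable (S : ExtriStructure.{w} C)

theorem sub_push {Z X X' : C} (a b : X ⟶ X') (δ : Extn S.E Z X) :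
    push S.E (a - b) δ = push S.E a δ - push S.E b δ := by
  have := S.additive_right Z
  simp only [push, Functor.map_sub]
  rfl

theorem zero_push {Z X X' : C} (δ : Extn S.E Z X) : push S.E (0 : X ⟶ X') δ = 0 := by
  simpa only [sub_self] using S.sub_push (0 : X ⟶ X') 0 δ

theorem zero_pull {Z Z' X : C} (δ : Extn S.E Z X) : pull S.E (0 : Z' ⟶ Z) δ = 0 := by
  have := S.additive_left X
  have hmap : (S.E.flip.obj X).map (0 : Z' ⟶ Z).op = 0 := by rw [op_zero, Functor.map_zero]
  exact ConcreteCategory.congr_hom hmap δ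

theorem tri_of_isIso_of_isZero {X Y Z : C} (x : X ⟶ Y) [IsIso x] (hZ : IsZero Z) (y : Y ⟶ Z) :
    S.Tri x y (0 : Extn S.E Z X) :=
  S.tri_of_iso ((isoBiprodZero hZ).symm ≪≫ asIso x) (by simp) (hZ.eq_of_tgt _ _)
    (S.tri_zero X Z)

theorem tri_of_isZero_of_isIso {X Y Z : C} (hX : IsZero X) (x : X ⟶ Y) (y : Y ⟶ Z) [IsIso y] :
    S.Tri x y (0 : Extn S.E Z X) :=
  S.tri_of_iso ((isoZeroBiprod hX).symm ≪≫ asIso (inv y)) (hX.eq_of_src _ _) (by simp)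
    (S.tri_zero X Z)

theorem tri_inr_fst (X Z : C) :
    S.Tri (biprod.inr : X ⟶ Z ⊞ X) (biprod.fst : Z ⊞ X ⟶ Z) (0 : Extn S.E Z X) :=
  S.tri_of_iso (biprod.braiding X Z) (by ext <;> simp) (by simp) (S.tri_zero X Z)

variable {S} {X Y Z : C} {x : X ⟶ Y} {y : Y ⟶ Z} {δ : Extn S.E Z X}

theorem Tri.comp_eq_zero (h : S.Tri x y δ) : x ≫ y = 0 := by
  obtain ⟨c, hc, -⟩ := S.et3 (S.tri_of_isIso_of_isZero (𝟙 X) (isZero_zero C) 0) h (𝟙 X) x rfl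
  simpa using hc.symm

theorem Tri.push_eq_zero (h : S.Tri x y δ) : push S.E x δ = 0 := by
  obtain ⟨c, -, hc⟩ := S.et3 h (S.tri_of_isIso_of_isZero (𝟙 Y) (isZero_zero C) 0) x (𝟙 Y) rfl
  rw [hc, pull_zero]

theorem Tri.pull_eq_zero (h : S.Tri x y δ) : pull S.E y δ = 0 := by
  obtain ⟨a, -, ha⟩ := S.et3_op (S.tri_of_isZero_of_isIso (isZero_zero C) 0 (𝟙 Y)) h (𝟙 Y) y rfl
  rw [← ha, push_zero]

theorem Tri.yoneda_exact₁ (h : S.Tri x y δ) {W : C} (a : X ⟶ W) (ha : push S.E a δ = 0) :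
    ∃ b : Y ⟶ W, a = x ≫ b := by
  obtain ⟨b, hb, -⟩ := S.realize_hom h (S.tri_of_isIso_of_isZero (𝟙 W) (isZero_zero C) 0) a 0
    (by rw [ha, pull_zero])
  exact ⟨b, by simpa using hb.symm⟩

theorem Tri.yoneda_exact₂ (h : S.Tri x y δ) {W : C} (b : Y ⟶ W) (hb : x ≫ b = 0) :
    ∃ c : Z ⟶ W, b = y ≫ c := by
  obtain ⟨c, hc, -⟩ := S.et3 h (S.tri_of_isZero_of_isIso (isZero_zero C) 0 (𝟙 W)) 0 b
    (by simp [hb])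
  exact ⟨c, by simpa using hc.symm⟩

theorem Tri.coyoneda_exact₂ (h : S.Tri x y δ) {W : C} (b : W ⟶ Y) (hb : b ≫ y = 0) :
    ∃ a : W ⟶ X, b = a ≫ x := by
  obtain ⟨a, ha, -⟩ := S.et3_op (S.tri_of_isIso_of_isZero (𝟙 W) (isZero_zero C) 0) h b 0
    (by simp [hb])
  exact ⟨a, by simpa using ha⟩

theorem Tri.coyoneda_exact₃ (h : S.Tri x y δ) {W : C} (c : W ⟶ Z) (hc : pull S.E c δ = 0) :
    ∃ b : W ⟶ Y, c = b ≫ y := by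
  obtain ⟨b, -, hb⟩ := S.realize_hom (S.tri_of_isZero_of_isIso (isZero_zero C) 0 (𝟙 W)) h 0 c
    (by rw [hc, push_zero])
  exact ⟨b, by simpa using hb⟩

theorem Tri.isIso_of_isZero_left (h : S.Tri x y δ) (hX : IsZero X) : IsIso y := by
  obtain rfl : δ = 0 := by rw [← push_id S.E δ, hX.eq_of_src (𝟙 X) 0, S.zero_push]
  obtain ⟨e, -, he⟩ := S.tri_unique h (S.tri_of_isZero_of_isIso hX 0 (𝟙 Z))
  rw [← he, Category.comp_id]
  infer_instance

theorem Tri.isIso_of_isZero_right (h : S.Tri x y δ) (hZ : IsZero Z) : IsIso x := by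
  obtain rfl : δ = 0 := by rw [← pull_id S.E δ, hZ.eq_of_src (𝟙 Z) 0, S.zero_pull]
  obtain ⟨e, he, -⟩ := S.tri_unique (S.tri_of_isIso_of_isZero (𝟙 X) hZ 0) h
  rw [← he, Category.id_comp]
  infer_instance

theorem Tri.isIso_endo₂ (h : S.Tri x y δ) {b : Y ⟶ Y} (hx : x ≫ b = x) (hy : b ≫ y = y) :
    IsIso b := by
  obtain ⟨c, hc⟩ := h.yoneda_exact₂ (𝟙 Y - b) (by simp [hx])
  refine isIso_of_sub_comp_sub_eq_zero ?_
  nth_rw 2 [hc]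
  simp [reassoc_of% hy]

theorem Tri.isIso_endo₁ (h : S.Tri x y δ) {a : X ⟶ X} (hx : a ≫ x = x)
    (ha : push S.E a δ = δ) : IsIso a := by
  obtain ⟨b, hb⟩ := h.yoneda_exact₁ (𝟙 X - a) (by rw [S.sub_push, push_id, ha, sub_self])
  refine isIso_of_sub_comp_sub_eq_zero ?_
  nth_rw 2 [hb]
  simp [reassoc_of% hx]

variable {X' Y' Z' : C} {x' : X' ⟶ Y'} {y' : Y' ⟶ Z'} {δ' : Extn S.E Z' X'}

theorem Tri.isIso₂_of_isIso₁₃ (h : S.Tri x y δ) (h' : S.Tri x' y' δ') (a : X ⟶ X') (b : Y ⟶ Y')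
    (c : Z ⟶ Z') (hab : x ≫ b = a ≫ x') (hbc : y ≫ c = b ≫ y')
    (hδ : push S.E a δ = pull S.E c δ') [IsIso a] [IsIso c] : IsIso b := by
  obtain ⟨b', hab', hbc'⟩ := S.realize_hom h' h (inv a) (inv c) (push_inv_eq_pull_inv S.E hδ)
  have : IsIso (b ≫ b') := h.isIso_endo₂ (by rw [reassoc_of% hab, hab', IsIso.hom_inv_id_assoc])
    (by rw [Category.assoc, ← hbc', ← reassoc_of% hbc, IsIso.hom_inv_id, Category.comp_id])
  have : IsIso (b' ≫ b) := h'.isIso_endo₂ (by rw [reassoc_of% hab', hab, IsIso.inv_hom_id_assoc])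
    (by rw [Category.assoc, ← hbc, ← reassoc_of% hbc', IsIso.inv_hom_id, Category.comp_id])
  exact isIso_of_isIso_comp_comp b b'

theorem Tri.nonempty_iso_fiber (h : S.Tri x y δ) {x' : X' ⟶ Y} {δ' : Extn S.E Z X'}
    (h' : S.Tri x' y δ') : Nonempty (X ≅ X') := by
  obtain ⟨a, ha, haδ⟩ := S.et3_op h h' (𝟙 Y) (𝟙 Z) (by simp)
  obtain ⟨a', ha', haδ'⟩ := S.et3_op h' h (𝟙 Y) (𝟙 Z) (by simp)
  rw [Category.comp_id] at ha ha'
  rw [pull_id] at haδ haδ'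
  have : IsIso (a ≫ a') := h.isIso_endo₁ (by rw [Category.assoc, ← ha', ← ha])
    (by rw [push_comp, haδ, haδ'])
  have : IsIso (a' ≫ a) := h'.isIso_endo₁ (by rw [Category.assoc, ← ha, ← ha'])
    (by rw [push_comp, haδ', haδ])
  exact ⟨@asIso _ _ _ _ a (isIso_of_isIso_comp_comp a a')⟩

theorem Tri.exists_split_deflation (h : S.Tri x y δ) {W : C} (f : Y ⟶ W) [IsIso (x ≫ f)] :
    ∃ s : Z ⟶ Y, S.Tri s f (0 : Extn S.E W Z) := by
  -- By the five lemma, `f` is the second projection of a direct sum decomposition `Y ≅ Z ⊞ W`.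
  have : IsIso (biprod.lift y f) :=
    h.isIso₂_of_isIso₁₃ (S.tri_inr_fst W Z) (x ≫ f) (biprod.lift y f) (𝟙 Z)
      (by ext <;> simp [h.comp_eq_zero]) (by simp)
      (by rw [push_comp, h.push_eq_zero, push_zero, pull_zero])
  exact ⟨_, S.tri_of_iso (asIso (biprod.lift y f)).symm rfl (by simp) (S.tri_zero Z W)⟩

theorem Tri.exists_split_inflation (h : S.Tri x y δ) {W : C} (g : W ⟶ Y) [IsIso (g ≫ y)] :
    ∃ r : Y ⟶ X, S.Tri g r (0 : Extn S.E X W) := by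
  have : IsIso (biprod.desc g x) :=
    (S.tri_inr_fst X W).isIso₂_of_isIso₁₃ h (𝟙 X) (biprod.desc g x) (g ≫ y)
      (by simp) (by ext <;> simp [h.comp_eq_zero])
      (by rw [pull_comp, h.pull_eq_zero, push_zero, pull_zero])
  exact ⟨inv (biprod.desc g x) ≫ biprod.snd,
    S.tri_of_iso (asIso (biprod.desc g x)) (by simp) (by simp) (S.tri_zero W X)⟩

theorem Tri.isMonoOn_of_isMonoOn {𝒳 : ObjectProperty C} (h : S.Tri x y δ) {f : Y ⟶ Y'}
    {y' : Y' ⟶ Z'} {δ' : Extn S.E Z' X} (h' : S.Tri (x ≫ f) y' δ') {c : Z ⟶ Z'}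
    (hc : y ≫ c = f ≫ y') (hδ : δ = pull S.E c δ') (hf : IsMonoOn 𝒳 f) : IsMonoOn 𝒳 c := by
  intro T hT g hgc
  obtain ⟨b, rfl⟩ := h.coyoneda_exact₃ g (by rw [hδ, ← pull_comp, hgc, S.zero_pull])
  obtain ⟨t, ht⟩ := h'.coyoneda_exact₂ (b ≫ f) (by rw [Category.assoc, ← hc, ← Category.assoc, hgc])
  have hb : b - t ≫ x = 0 := hf hT _ (by
    rw [Preadditive.sub_comp, ht, Category.assoc, sub_self])
  rw [sub_eq_zero.1 hb, Category.assoc, h.comp_eq_zero, comp_zero]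

end Triangles

section Filtrations

variable {S : ExtriStructure.{w} C} {𝒳 : ObjectProperty C} {n m : ℕ} {X L M N T : C}

theorem HasFiltration.of_iso (h : S.HasFiltration 𝒳 n M) (e : M ≅ N) :
    S.HasFiltration 𝒳 n N := by
  cases h with
  | zero hM => exact .zero (hM.of_iso e.symm)
  | succ hM f g δ h hX =>
    exact .succ hM (f ≫ e.hom) (e.inv ≫ g) δ (S.tri_of_iso e rfl (by simp) h) hX

theorem hasFiltration_zero_iff : S.HasFiltration 𝒳 0 M ↔ IsZero M :=
  ⟨fun | .zero hM => hM, .zero⟩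

theorem hasFiltration_one (hT : 𝒳 T) : S.HasFiltration 𝒳 1 T :=
  .succ (.zero (isZero_zero C)) 0 (𝟙 T) 0 (S.tri_of_isZero_of_isIso (isZero_zero C) 0 (𝟙 T)) hT

theorem Tri.hasFiltration_add {x : X ⟶ L} {y : L ⟶ M} {δ : Extn S.E M X} (h : S.Tri x y δ)
    (hX : S.HasFiltration 𝒳 n X) (hM : S.HasFiltration 𝒳 m M) :
    S.HasFiltration 𝒳 (n + m) L := by
  induction hM generalizing L with
  | zero hM =>
    have := h.isIso_of_isZero_right hM
    exact hX.of_iso (asIso x)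
  | succ _ f g δ' h' hT ih =>
    obtain ⟨K, d, e, k, δ'', hk, -, -, hde, -, -⟩ := S.et4_op h h'
    exact .succ (ih hde) k (y ≫ g) δ'' hk hT

theorem HasFiltration.exists_first (hM : S.HasFiltration 𝒳 (n + 1) M) :
    ∃ (T M' : C) (x : T ⟶ M) (y : M ⟶ M') (δ : Extn S.E M' T),
      𝒳 T ∧ S.HasFiltration 𝒳 n M' ∧ S.Tri x y δ := by
  induction n generalizing M with
  | zero =>
    obtain _ | ⟨hM', f, g, δ, h, hT⟩ := hM
    have := h.isIso_of_isZero_left (hasFiltration_zero_iff.1 hM')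
    exact ⟨_, _, inv g, 0, 0, hT, .zero (isZero_zero C),
      S.tri_of_isIso_of_isZero (inv g) (isZero_zero C) 0⟩
  | succ n ih =>
    obtain _ | ⟨hM', f, g, δ, h, hT⟩ := hM
    obtain ⟨T, M'', x, y, δ', hT', hM'', h'⟩ := ih hM'
    obtain ⟨L, k, d, e, δ'', hk, -, -, hde, -, -⟩ := S.et4 h' h
    exact ⟨T, L, x ≫ f, k, δ'', hT', .succ hM'' d e _ hde hT, hk⟩

theorem leftOrthogonal_le_leftOrthogonal_filt :
    𝒳.leftOrthogonal ≤ (S.Filt 𝒳).leftOrthogonal := by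
  rintro M hM N f ⟨n, hN⟩
  induction hN with
  | zero hN => exact hN.eq_of_tgt _ _
  | succ _ x y δ h hT ih =>
    obtain ⟨a, rfl⟩ := h.coyoneda_exact₂ f (hM _ hT)
    rw [ih a, zero_comp]

theorem rightOrthogonal_le_rightOrthogonal_filt :
    𝒳.rightOrthogonal ≤ (S.Filt 𝒳).rightOrthogonal := by
  rintro M hM N f ⟨n, hN⟩
  induction hN with
  | zero hN => exact hN.eq_of_src _ _
  | succ _ x y δ h hT ih =>
    obtain ⟨c, rfl⟩ := h.yoneda_exact₂ f (ih _)
    rw [hM c hT, comp_zero]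

theorem Filt.exists_hom_to_ne_zero (hM : S.Filt 𝒳 M) (h0 : ¬ IsZero M) :
    ∃ (T : C) (f : M ⟶ T), 𝒳 T ∧ f ≠ 0 := by
  by_contra! hcon
  have hM' : 𝒳.leftOrthogonal M := fun T f hT => hcon T f hT
  exact h0 ((IsZero.iff_id_eq_zero M).2 (leftOrthogonal_le_leftOrthogonal_filt M hM' (𝟙 M) hM))

theorem Filt.exists_hom_from_ne_zero (hM : S.Filt 𝒳 M) (h0 : ¬ IsZero M) :
    ∃ (T : C) (g : T ⟶ M), 𝒳 T ∧ g ≠ 0 := by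
  by_contra! hcon
  have hM' : 𝒳.rightOrthogonal M := fun T g hT => hcon T g hT
  exact h0 ((IsZero.iff_id_eq_zero M).2 (rightOrthogonal_le_rightOrthogonal_filt M hM' (𝟙 M) hM))

theorem HasFiltration.exists_fiber (hM : S.HasFiltration 𝒳 n M) (h𝒳 : IsSemibrick 𝒳) (hT : 𝒳 T)
    {f : M ⟶ T} (hf : f ≠ 0) :
    ∃ (m : ℕ) (K : C) (k : K ⟶ M) (δ : Extn S.E T K),
      n = m + 1 ∧ S.HasFiltration 𝒳 m K ∧ S.Tri k f δ := by
  induction n generalizing M with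
  | zero => exact (hf ((hasFiltration_zero_iff.1 hM).eq_of_src _ _)).elim
  | succ n ih =>
    obtain ⟨T', M', x, y, δ, hT', hM', h⟩ := hM.exists_first
    by_cases hxf : x ≫ f = 0
    · obtain ⟨f', rfl⟩ := h.yoneda_exact₂ f hxf
      have hf' : f' ≠ 0 := fun h0 => hf (by rw [h0, comp_zero])
      obtain ⟨m, K', k', δ', rfl, hK', h'⟩ := ih hM' hf'
      obtain ⟨K, d, e, k, δ'', hk, -, -, hde, -, -⟩ := S.et4_op h h'
      exact ⟨1 + m, K, k, δ'', by omega, hde.hasFiltration_add (hasFiltration_one hT') hK', hk⟩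
    · have := h𝒳.isIso_of_ne_zero hT' hT hxf
      obtain ⟨s, hs⟩ := h.exists_split_deflation f
      exact ⟨n, M', s, 0, rfl, hM', hs⟩

theorem HasFiltration.exists_cone (hM : S.HasFiltration 𝒳 n M) (h𝒳 : IsSemibrick 𝒳) (hT : 𝒳 T)
    {g : T ⟶ M} (hg : g ≠ 0) :
    ∃ (m : ℕ) (K : C) (k : M ⟶ K) (δ : Extn S.E K T),
      n = m + 1 ∧ S.HasFiltration 𝒳 m K ∧ S.Tri g k δ := by
  induction hM with
  | zero hM => exact (hg (hM.eq_of_tgt _ _)).elim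
  | @succ n M' M T' hM' x y δ h hT' ih =>
    by_cases hgy : g ≫ y = 0
    · obtain ⟨g', rfl⟩ := h.coyoneda_exact₂ g hgy
      have hg' : g' ≠ 0 := fun h0 => hg (by rw [h0, zero_comp])
      obtain ⟨m, K', k', δ', rfl, hK', h'⟩ := ih hg'
      obtain ⟨K, k, d, e, δ'', hk, -, -, hde, -, -⟩ := S.et4 h' h
      exact ⟨m + 1, K, k, δ'', rfl, .succ hK' d e _ hde hT', hk⟩
    · have := h𝒳.isIso_of_ne_zero hT hT' hgy
      obtain ⟨r, hr⟩ := h.exists_split_inflation g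
      exact ⟨n, M', r, 0, rfl, hM', hr⟩

theorem HasFiltration.filtLength_le (hM : S.HasFiltration 𝒳 n M) : S.filtLength 𝒳 M ≤ n :=
  Nat.sInf_le hM

theorem Filt.hasFiltration_filtLength (hM : S.Filt 𝒳 M) :
    S.HasFiltration 𝒳 (S.filtLength 𝒳 M) M :=
  Nat.sInf_mem hM

theorem filtLength_congr (e : M ≅ N) : S.filtLength 𝒳 M = S.filtLength 𝒳 N :=
  congrArg sInf (Set.ext fun _ => ⟨fun h => h.of_iso e, fun h => h.of_iso e.symm⟩)

theorem Filt.filtLength_eq_zero_iff (hM : S.Filt 𝒳 M) : S.filtLength 𝒳 M = 0 ↔ IsZero M :=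
  ⟨fun h => hasFiltration_zero_iff.1 (h ▸ hM.hasFiltration_filtLength),
    fun h => Nat.le_zero.1 (HasFiltration.zero h).filtLength_le⟩

theorem Tri.filtLength_le {x : X ⟶ L} {y : L ⟶ M} {δ : Extn S.E M X} (h : S.Tri x y δ)
    (hX : S.Filt 𝒳 X) (hM : S.Filt 𝒳 M) :
    S.filtLength 𝒳 L ≤ S.filtLength 𝒳 X + S.filtLength 𝒳 M :=
  (h.hasFiltration_add hX.hasFiltration_filtLength hM.hasFiltration_filtLength).filtLength_le

theorem filtLength_eq_one (hT : 𝒳 T) (h0 : ¬ IsZero T) : S.filtLength 𝒳 T = 1 :=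
  le_antisymm (hasFiltration_one hT).filtLength_le (Nat.one_le_iff_ne_zero.2
    (mt (Filt.filtLength_eq_zero_iff ⟨1, hasFiltration_one hT⟩).1 h0))

end Filtrations

section LengthFunctions

variable {S : ExtriStructure.{w} C} {Θ : C → ℕ} (hΘ : S.IsLengthFunction Θ) {L M N : C}
include hΘ

theorem IsLengthFunction.isDeflation_of_isIso (f : M ⟶ N) [IsIso f] : S.IsDeflation Θ f :=
  ⟨_, 0, 0, S.tri_of_isZero_of_isIso (isZero_zero C) 0 f, by
    rw [(hΘ.eq_zero_iff _).2 (isZero_zero C), zero_add, hΘ.iso_invariant M N ⟨asIso f⟩]⟩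

theorem IsLengthFunction.isInflation_of_isIso (f : M ⟶ N) [IsIso f] : S.IsInflation Θ f :=
  ⟨_, 0, 0, S.tri_of_isIso_of_isZero f (isZero_zero C) 0, by
    rw [(hΘ.eq_zero_iff _).2 (isZero_zero C), add_zero, hΘ.iso_invariant M N ⟨asIso f⟩]⟩

theorem IsLengthFunction.isDeflation_comp {f : L ⟶ M} {g : M ⟶ N} (hf : S.IsDeflation Θ f)
    (hg : S.IsDeflation Θ g) : S.IsDeflation Θ (f ≫ g) := by
  obtain ⟨X, x, δ, hx, hfx⟩ := hf
  obtain ⟨Y, y, ε, hy, hgy⟩ := hg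
  obtain ⟨K, d, e, k, δ'', hk, -, -, hde, -, -⟩ := S.et4_op hx hy
  have hL : Θ L ≤ Θ K + Θ N := hΘ.subadditive _ _ _ hk
  have hK : Θ K ≤ Θ X + Θ Y := hΘ.subadditive _ _ _ hde
  exact ⟨K, k, δ'', hk, by omega⟩

theorem IsLengthFunction.isInflation_comp {f : L ⟶ M} {g : M ⟶ N} (hf : S.IsInflation Θ f)
    (hg : S.IsInflation Θ g) : S.IsInflation Θ (f ≫ g) := by
  obtain ⟨X, x, δ, hx, hfx⟩ := hf
  obtain ⟨Y, y, ε, hy, hgy⟩ := hg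
  obtain ⟨K, k, d, e, δ'', hk, -, -, hde, -, -⟩ := S.et4 hx hy
  have hN : Θ N ≤ Θ L + Θ K := hΘ.subadditive _ _ _ hk
  have hK : Θ K ≤ Θ X + Θ Y := hΘ.subadditive _ _ _ hde
  exact ⟨K, k, δ'', hk, by omega⟩

theorem IsLengthFunction.isAdmissible_of_isIso (f : M ⟶ N) [IsIso f] : S.IsAdmissible Θ f :=
  ⟨M, 𝟙 M, f, hΘ.isDeflation_of_isIso (𝟙 M), hΘ.isInflation_of_isIso f, Category.id_comp f⟩

theorem IsLengthFunction.isAdmissible_deflation_comp {f : L ⟶ M} {g : M ⟶ N}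
    (hf : S.IsDeflation Θ f) (hg : S.IsAdmissible Θ g) : S.IsAdmissible Θ (f ≫ g) := by
  obtain ⟨X, i, j, hi, hj, rfl⟩ := hg
  exact ⟨X, f ≫ i, j, hΘ.isDeflation_comp hf hi, hj, Category.assoc f i j⟩

theorem IsLengthFunction.isAdmissible_comp_inflation {f : L ⟶ M} {g : M ⟶ N}
    (hf : S.IsAdmissible Θ f) (hg : S.IsInflation Θ g) : S.IsAdmissible Θ (f ≫ g) := by
  obtain ⟨X, i, j, hi, hj, rfl⟩ := hf
  exact ⟨X, i, j ≫ g, hi, hΘ.isInflation_comp hj hg, (Category.assoc i j g).symm⟩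

end LengthFunctions

namespace IsSimpleMindedSystem

variable {S : ExtriStructure.{w} C} {𝒳 : ObjectProperty C} (h𝒳 : S.IsSimpleMindedSystem 𝒳)
  {X L M N T : C}
include h𝒳

theorem filtLength_eq_zero_iff (M : C) : S.filtLength 𝒳 M = 0 ↔ IsZero M :=
  (h𝒳.filt_eq_top M).filtLength_eq_zero_iff

theorem filtLength_le {x : X ⟶ L} {y : L ⟶ M} {δ : Extn S.E M X} (h : S.Tri x y δ) :
    S.filtLength 𝒳 L ≤ S.filtLength 𝒳 X + S.filtLength 𝒳 M :=
  h.filtLength_le (h𝒳.filt_eq_top X) (h𝒳.filt_eq_top M)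

theorem filtLength_eq_one (hT : 𝒳 T) : S.filtLength 𝒳 T = 1 :=
  ExtriStructure.filtLength_eq_one hT fun h =>
    (h𝒳.semibrick.brick T hT).id_ne_zero (h.eq_of_src _ _)

theorem isDeflation_of_ne_zero (hT : 𝒳 T) {f : M ⟶ T} (hf : f ≠ 0) :
    S.IsDeflation (S.filtLength 𝒳) f := by
  obtain ⟨m, K, k, δ, hm, hK, h⟩ :=
    (h𝒳.filt_eq_top M).hasFiltration_filtLength.exists_fiber h𝒳.semibrick hT hf
  have hKm := hK.filtLength_le
  have hM := h𝒳.filtLength_le h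
  have hT1 := h𝒳.filtLength_eq_one hT
  exact ⟨K, k, δ, h, by omega⟩

theorem isInflation_of_ne_zero (hT : 𝒳 T) {g : T ⟶ M} (hg : g ≠ 0) :
    S.IsInflation (S.filtLength 𝒳) g := by
  obtain ⟨m, K, k, δ, hm, hK, h⟩ :=
    (h𝒳.filt_eq_top M).hasFiltration_filtLength.exists_cone h𝒳.semibrick hT hg
  have hKm := hK.filtLength_le
  have hM := h𝒳.filtLength_le h
  have hT1 := h𝒳.filtLength_eq_one hT
  exact ⟨K, k, δ, h, by omega⟩

theorem exists_fiber_of_ne_zero (hT : 𝒳 T) {f : M ⟶ T} (hf : f ≠ 0) :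
    ∃ (K : C) (k : K ⟶ M) (δ : Extn S.E T K),
      S.Tri k f δ ∧ S.filtLength 𝒳 M = S.filtLength 𝒳 K + 1 := by
  obtain ⟨K, k, δ, h, hl⟩ := h𝒳.isDeflation_of_ne_zero hT hf
  exact ⟨K, k, δ, h, by rw [hl, h𝒳.filtLength_eq_one hT]⟩

theorem exists_cone_of_ne_zero (hT : 𝒳 T) {g : T ⟶ M} (hg : g ≠ 0) :
    ∃ (K : C) (k : M ⟶ K) (δ : Extn S.E K T),
      S.Tri g k δ ∧ S.filtLength 𝒳 M = S.filtLength 𝒳 K + 1 := by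
  obtain ⟨K, k, δ, h, hl⟩ := h𝒳.isInflation_of_ne_zero hT hg
  exact ⟨K, k, δ, h, by rw [hl, h𝒳.filtLength_eq_one hT, add_comm]⟩

theorem filtLength_le_of_retract (r : Retract N M) :
    S.filtLength 𝒳 N ≤ S.filtLength 𝒳 M := by
  induction hn : S.filtLength 𝒳 N generalizing N M with
  | zero => exact Nat.zero_le _
  | succ n ih =>
    obtain ⟨T, f, hT, hf⟩ := (h𝒳.filt_eq_top N).exists_hom_to_ne_zero
      ((h𝒳.filtLength_eq_zero_iff N).not.1 (by omega))
    have hrf : r.r ≫ f ≠ 0 := fun h0 => hf (by rw [← r.retract_assoc f, h0, comp_zero])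
    obtain ⟨N', j, δ, hj, hN'⟩ := h𝒳.exists_fiber_of_ne_zero hT hf
    obtain ⟨M', k, ε, hk, hM'⟩ := h𝒳.exists_fiber_of_ne_zero hT hrf
    obtain ⟨a, ha, haδ⟩ := S.et3_op hj hk r.i (𝟙 T) (by simp)
    obtain ⟨b, hb, hbε⟩ := S.et3_op hk hj r.r (𝟙 T) (by simp)
    rw [pull_id] at haδ hbε
    have : IsIso (a ≫ b) := hj.isIso_endo₁
      (by rw [Category.assoc, ← hb, ← reassoc_of% ha, r.retract, Category.comp_id])
      (by rw [push_comp, haδ, hbε])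
    have hle := ih (N := N') (M := M')
      ⟨a, b ≫ inv (a ≫ b), by rw [← Category.assoc, IsIso.hom_inv_id]⟩ (by omega)
    omega

theorem filtLength_add_le_of_split {x : X ⟶ L} {y : L ⟶ M}
    (h : S.Tri x y (0 : Extn S.E M X)) :
    S.filtLength 𝒳 X + S.filtLength 𝒳 M ≤ S.filtLength 𝒳 L := by
  induction hn : S.filtLength 𝒳 M generalizing L M with
  | zero =>
    have := h.isIso_of_isZero_right ((h𝒳.filtLength_eq_zero_iff M).1 hn)
    exact (filtLength_congr (asIso x)).le
  | succ n ih =>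
    obtain ⟨T, f, hT, hf⟩ := (h𝒳.filt_eq_top M).exists_hom_to_ne_zero
      ((h𝒳.filtLength_eq_zero_iff M).not.1 (by omega))
    obtain ⟨s, hs⟩ := h.coyoneda_exact₃ (𝟙 M) (pull_zero S.E _)
    have hyf : y ≫ f ≠ 0 := fun h0 => hf (by
      rw [← Category.id_comp f, hs, Category.assoc, h0, comp_zero])
    obtain ⟨M', i, ε, hi, hM'⟩ := h𝒳.exists_fiber_of_ne_zero hT hf
    obtain ⟨K, d, e, k, ε', hk, -, -, hde, -, -⟩ := S.et4_op h hi
    rw [pull_zero] at hde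
    have hK := ih hde (by omega)
    obtain ⟨K', k', ε'', hk', hL⟩ := h𝒳.exists_fiber_of_ne_zero hT hyf
    obtain ⟨e'⟩ := hk.nonempty_iso_fiber hk'
    have := filtLength_congr (S := S) (𝒳 := 𝒳) e'
    omega

theorem isLengthFunction : S.IsLengthFunction (S.filtLength 𝒳) where
  iso_invariant _ _ := fun ⟨e⟩ => filtLength_congr e
  eq_zero_iff := h𝒳.filtLength_eq_zero_iff
  subadditive _ _ _ h := h𝒳.filtLength_le h
  additive_of_split _ _ h := le_antisymm (h𝒳.filtLength_le h) (h𝒳.filtLength_add_le_of_split h)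

theorem isEpiOn_of_isDeflation {y : L ⟶ M} (hy : S.IsDeflation (S.filtLength 𝒳) y) :
    IsEpiOn 𝒳 y := by
  intro T hT f hyf
  by_contra hf
  obtain ⟨X, x, δ, h, hl⟩ := hy
  obtain ⟨K, k, ε, hk, hM⟩ := h𝒳.exists_fiber_of_ne_zero hT hf
  obtain ⟨F, d, e, j, ε', hj, -, -, hde, -, -⟩ := S.et4_op h hk
  obtain ⟨s, hs⟩ := hj.coyoneda_exact₂ (𝟙 L) (by rw [hyf, comp_zero])
  have hLF := h𝒳.filtLength_le_of_retract ⟨s, j, hs.symm⟩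
  have hF := h𝒳.filtLength_le hde
  omega

theorem isIso_of_isMonoOn_of_isEpiOn {f : M ⟶ N} (hmono : IsMonoOn 𝒳 f) (hepi : IsEpiOn 𝒳 f) :
    IsIso f := by
  induction hn : S.filtLength 𝒳 M generalizing M N with
  | zero =>
    have hM : IsZero M := (h𝒳.filtLength_eq_zero_iff M).1 hn
    have hN : IsZero N := by
      by_contra hN
      obtain ⟨T, g, hT, hg⟩ := (h𝒳.filt_eq_top N).exists_hom_to_ne_zero hN
      exact hg (hepi hT g (hM.eq_of_src _ _))
    exact isIso_of_source_target_iso_zero f hM.isoZero hN.isoZero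
  | succ n ih =>
    obtain ⟨T, g, hT, hg⟩ := (h𝒳.filt_eq_top M).exists_hom_from_ne_zero
      ((h𝒳.filtLength_eq_zero_iff M).not.1 (by omega))
    obtain ⟨M', p, δ, hp, hM'⟩ := h𝒳.exists_cone_of_ne_zero hT hg
    obtain ⟨N', q, ε, hq⟩ := h𝒳.isInflation_of_ne_zero hT (mt (hmono hT g) hg)
    obtain ⟨f', hpf, hδ⟩ := S.et3 hp hq.1 (𝟙 T) f (by simp)
    have hmono' : IsMonoOn 𝒳 f' :=
      hp.isMonoOn_of_isMonoOn hq.1 hpf (by rw [← hδ, push_id]) hmono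
    have hepi' : IsEpiOn 𝒳 f' := by
      refine IsEpiOn.of_comp (f := p) ?_
      rw [hpf]
      exact hepi.comp (h𝒳.isEpiOn_of_isDeflation ⟨T, g ≫ f, ε, hq⟩)
    have : IsIso f' := ih hmono' hepi' (by omega)
    exact hp.isIso₂_of_isIso₁₃ hq.1 (𝟙 T) f f' (by simp) hpf hδ

theorem isAdmissible (f : M ⟶ N) : S.IsAdmissible (S.filtLength 𝒳) f := by
  induction hn : S.filtLength 𝒳 M + S.filtLength 𝒳 N using Nat.strong_induction_on
    generalizing M N with
  | _ n ih =>
    by_cases hmono : IsMonoOn 𝒳 f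
    · by_cases hepi : IsEpiOn 𝒳 f
      · have := h𝒳.isIso_of_isMonoOn_of_isEpiOn hmono hepi
        exact h𝒳.isLengthFunction.isAdmissible_of_isIso f
      · simp only [IsEpiOn, not_forall] at hepi
        obtain ⟨T, hT, h, hfh, hh⟩ := hepi
        obtain ⟨K, k, δ, hk⟩ := h𝒳.isDeflation_of_ne_zero hT hh
        obtain ⟨f', rfl⟩ := hk.1.coyoneda_exact₂ f hfh
        have hlt : S.filtLength 𝒳 K < S.filtLength 𝒳 N := by
          rw [hk.2, h𝒳.filtLength_eq_one hT]
          omega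
        exact h𝒳.isLengthFunction.isAdmissible_comp_inflation (ih _ (by omega) f' rfl)
          ⟨T, h, δ, hk⟩
    · simp only [IsMonoOn, not_forall] at hmono
      obtain ⟨T, hT, g, hgf, hg⟩ := hmono
      obtain ⟨K, k, δ, hk⟩ := h𝒳.isInflation_of_ne_zero hT hg
      obtain ⟨f', rfl⟩ := hk.1.yoneda_exact₂ f hgf
      have hlt : S.filtLength 𝒳 K < S.filtLength 𝒳 M := by
        rw [hk.2, h𝒳.filtLength_eq_one hT]
        omega
      exact h𝒳.isLengthFunction.isAdmissible_deflation_comp ⟨T, g, δ, hk⟩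
        (ih _ (by omega) f' rfl)

end IsSimpleMindedSystem

end ExtriStructure

end Extri

theorem theorem3 {C : Type u} [Category.{v} C] [Preadditive C] [HasZeroObject C]
    [HasBinaryBiproducts C]
    (S : Extri.ExtriStructure.{w} C) (𝒳 : ObjectProperty C)
    (h𝒳 : S.IsSimpleMindedSystem 𝒳) :
    S.IsLengthCategory (S.filtLength 𝒳) :=
  ⟨h𝒳.isLengthFunction, h𝒳.isAdmissible⟩
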